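/- Let $\mathbf{U} \in \mathbf{U}^+$ be (Grothendieck) universes, and let $\kappa \le \lambda$ be regular cardinals in $\mathbf{U}$. Definitions. Let $\mathbf{V}$ be either of the two universes and let $\mu$ be a regular cardinal in $\mathbf{V}$. An object $A$ of a category is $(\mu, \mathbf{V})$-compact if $\mathrm{Hom}(A, -)$ preserves colimits of $\mathbf{V}$-small $\mu$-filtered diagrams. A $\mu$-accessible $\mathbf{V}$-category is a locally $\mathbf{V}$-small category that has colimits of all $\mathbf{V}$-small $\mu$-filtered diagrams and a $\mathbf{V}$-small set $\mathcal{G}$ of $(\mu, \mathbf{V})$-compact objects such that every object is the colimit of a $\mathbf{V}$-small $\mu$-filtered diagram of objects in $\mathcal{G}$. It is a locally $\mu$-presentable $\mathbf{V}$-category if it moreover has colimits of all $\mathbf{V}$-small diagrams. A functor is $(\mu, \mathbf{V})$-accessible if its domain is a $\mu$-accessible $\mathbf{V}$-category and it preserves colimits of $\mathbf{V}$-small $\mu$-filtered diagrams. For $\mu$ a regular cardinal in $\mathbf{U}$, a $(\mu, \mathbf{U}, \mathbf{U}^+)$-accessible extension is a $(\mu, \mathbf{U})$-accessible functor $i : \mathcal{C}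 \to \mathcal{C}^+$, where $\mathcal{C}$ is a $\mu$-accessible $\mathbf{U}$-category and $\mathcal{C}^+$ is a $\mu$-accessible $\mathbf{U}^+$-category, which sends $(\mu, \mathbf{U})$-compact objects to $(\mu, \mathbf{U}^+)$-compact objects, and for which the induced functor between the full subcategories of $(\mu, \mathbf{U})$-compact objects of $\mathcal{C}$ and of $(\mu, \mathbf{U}^+)$-compact objects of $\mathcal{C}^+$ is fully faithful and essentially surjective on objects. Let $F \dashv G : \mathcal{D} \to \mathcal{C}$ and $F' \dashv G' : \mathcal{D}' \to \mathcal{C}'$ be adjunctions with units $\eta, \eta'$ and counits $\varepsilon, \varepsilon'$, and let $H : \mathcal{C} \to \mathcal{C}'$ and $K : \mathcal{D} \to \mathcal{D}'$ be functors. A natural isomorphism $\alpha : HG \Rightarrow G'K$ satisfies the left Beck–Chevalley condition if its mate $\varepsilon' K F \bullet F' \alpha F \bullet F' H \eta : F' H \Rightarrow K F$ is a natural isomorphism, and a natural isomorphism $\beta : F' H \Rightarrow K F$ satisfies the right Beck–Chevalley condition if its mate $G' K \varepsilon \bullet G' \beta G \bullet \eta' H G : H G \Rightarrow G' K$ is a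 natural isomorphism. A strictly commutative square is regarded as such a square with $\alpha$ (resp. $\beta$) the identity. Theorem (Stability of accessible adjoint functors). Let $\mathcal{C}$ be a locally $\kappa$-presentable $\mathbf{U}$-category, $\mathcal{D}$ a locally $\lambda$-presentable $\mathbf{U}$-category, $\mathcal{C}^+$ a locally $\kappa$-presentable $\mathbf{U}^+$-category, and $\mathcal{D}^+$ a locally $\lambda$-presentable $\mathbf{U}^+$-category. Let $i : \mathcal{C} \to \mathcal{C}^+$ be a $(\kappa, \mathbf{U}, \mathbf{U}^+)$-accessible extension and let $j : \mathcal{D} \to \mathcal{D}^+$ be a fully faithful functor. (i) Let $G : \mathcal{D} \to \mathcal{C}$ be a $(\lambda, \mathbf{U})$-accessible functor and $G^+ : \mathcal{D}^+ \to \mathcal{C}^+$ a $(\lambda, \mathbf{U}^+)$-accessible functor with $G^+ j = i G$ (strictly). If $G$ and $G^+$ both have left adjoints and $j$ is a $(\lambda, \mathbf{U}, \mathbf{U}^+)$-accessible extension, then the square $G^+ j = i G$ satisfies the left Beck–Chevalley condition: for all choices of left adjoints $F \dashv G$ and $F^+ \dashv G^+$, the canonical natural transformation $F^+ i \Rightarrow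 j F$ is an isomorphism. (ii) Let $F : \mathcal{C} \to \mathcal{D}$ and $F^+ : \mathcal{C}^+ \to \mathcal{D}^+$ be functors with $F^+ i = j F$ (strictly). If $F$ and $F^+$ both have right adjoints, then the square $F^+ i = j F$ satisfies the right Beck–Chevalley condition: for all choices of right adjoints $F \dashv G$ and $F^+ \dashv G^+$, the canonical natural transformation $i G \Rightarrow G^+ j$ is an isomorphism. -/

import Mathlib

open CategoryTheory Limits

universe w w' v₁ v₂ v₃ v₄ u₁ u₂ u₃ u₄

namespace UniverseEnlargement

/-- A regular cardinal of the universe `Type w` is still regular when it is regarded as a cardinal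
of the larger universe `Type (max w w')`. -/
instance fact_isRegular_lift (κ : Cardinal.{w}) [hκ : Fact κ.IsRegular] :
    Fact (Cardinal.lift.{w', w} κ).IsRegular :=
  ⟨hκ.out.lift⟩

section AccessibleExtension

variable {C : Type u₁} [Category.{v₁} C] {C' : Type u₂} [Category.{v₂} C']

/-- Let `U` be the universe `Type w`, let `U⁺` be the universe `Type (max w w')`, and let `κ` be a
regular cardinal in `U`, which is `Cardinal.lift.{w', w} κ` when it is regarded as an element of
`U⁺`. A functor `i : C ⥤ C'` is a `(κ, U, U⁺)`-accessible extension if `C` is a `κ`-accessible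
`U`-category, `C'` is a `κ`-accessible `U⁺`-category, `i` preserves colimits of `U`-small
`κ`-filtered diagrams, `i` sends `(κ, U)`-compact objects of `C` to `(κ, U⁺)`-compact objects
of `C'`, and the functor that `i` induces between the full subcategories of these objects is
fully faithful and essentially surjective. -/
structure IsAccessibleExtension (κ : Cardinal.{w}) [Fact κ.IsRegular] (i : C ⥤ C') : Prop where
  isCardinalAccessibleCategory_source : IsCardinalAccessibleCategory C κ
  isCardinalAccessible : i.IsCardinalAccessible κ
  isCardinalAccessibleCategory_target :
    IsCardinalAccessibleCategory C' (Cardinal.lift.{w', w} κ)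
  map_compact (X : (isCardinalPresentable C κ).FullSubcategory) :
    isCardinalPresentable C' (Cardinal.lift.{w', w} κ)
      (((isCardinalPresentable C κ).ι ⋙ i).obj X)
  full_compact :
    ((isCardinalPresentable C' (Cardinal.lift.{w', w} κ)).lift
      ((isCardinalPresentable C κ).ι ⋙ i) map_compact).Full
  faithful_compact :
    ((isCardinalPresentable C' (Cardinal.lift.{w', w} κ)).lift
      ((isCardinalPresentable C κ).ι ⋙ i) map_compact).Faithful
  essSurj_compact :
    ((isCardinalPresentable C' (Cardinal.lift.{w', w} κ)).lift
      ((isCardinalPresentable C κ).ι ⋙ i) map_compact).EssSurj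

end AccessibleExtension

section BeckChevalley

variable {C : Type u₁} [Category.{v₁} C] {C' : Type u₂} [Category.{v₂} C']
  {D : Type u₃} [Category.{v₃} D] {D' : Type u₄} [Category.{v₄} D']
  {F : C ⥤ D} {G : D ⥤ C} {F' : C' ⥤ D'} {G' : D' ⥤ C'} {H : C ⥤ C'} {K : D ⥤ D'}

/-- The left Beck–Chevalley condition for a square of right adjoints that commutes up to the
natural isomorphism `α : H G ≅ G' K`: the mate `F' H ⟶ K F` of `α` is a natural isomorphism. -/
def LeftBeckChevalley (adj : F ⊣ G) (adj' : F' ⊣ G') (α : G ⋙ H ≅ K ⋙ G') : Prop :=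
  IsIso ((mateEquiv adj adj').symm (TwoSquare.mk G K H G' α.hom)).natTrans

/-- The right Beck–Chevalley condition for a square of left adjoints that commutes up to the
natural isomorphism `β : F' H ≅ K F`: the mate `H G ⟶ G' K` of `β` is a natural isomorphism. -/
def RightBeckChevalley (adj : F ⊣ G) (adj' : F' ⊣ G') (β : H ⋙ F' ≅ F ⋙ K) : Prop :=
  IsIso (mateEquiv adj adj' (TwoSquare.mk H F F' K β.hom)).natTrans

end BeckChevalley

end UniverseEnlargement

/-!
Write `U` for the universe `Type w` and `U⁺` for the larger universe.

An accessible extension `i : C ⥤ C'` is fully faithful (`IsAccessibleExtension.map_bijective`):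
between compact objects this is part of the definition, and it propagates to all objects of `C`
because `i` preserves their presentations as filtered colimits of compact objects and sends compact
objects to compact objects.

*Right adjoints.* The mate `i G ⟶ G' j` is invertible as soon as it induces bijections on
`Hom(i k, -)` for `k` compact in `C`, because the objects `i k` form a strong generator of `C'`. By the
adjunctions and full faithfulness, both `Hom(i k, i G d)` and `Hom(i k, G' j d) ≃ Hom(j F k, j d)`
are identified with `Hom(k, G d) ≃ Hom(F k, d)`.

*Left adjoints.* The mate `F' i ⟶ j F` is invertible at `c` as soon as the induced map
`Hom(j F c, d') ⟶ Hom(i c, G' d')` is bijective for all `d'` in `D'`. For `d' = j d` it is the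
bijection `Hom(F c, d) ≃ Hom(c, G d)`. To reach all `d'`, choose a regular cardinal `μ` of `U` so
large that `i c` and `j F c` are `(μ, U⁺)`-compact. Both sides then commute with `U⁺`-small
`μ`-filtered colimits in `d'`, and it remains to write `d'` as such a colimit of objects in the
essential image of `j`
(`IsAccessibleExtension.exists_isCardinalFiltered_presentation`). By definition `d'` is the colimit
of compact objects indexed by a `λ`-directed poset. The `λ`-directed subsets of that poset with
fewer than `μ` elements have their colimits in the essential image of `j`, and they form a
`μ`-directed cover of the poset if `μ` is the successor of some `2 ^ θ` with `θ ≥ λ`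
(`exists_isCardinalFiltered_superset`).
-/

namespace UniverseEnlargement

/-! ### Directed subsets of bounded cardinality -/

open Cardinal in
/-- If `κ ≤ θ`, then every set `S` of at most `2 ^ θ` elements of a `κ`-directed poset is contained
in a `κ`-directed subset of at most `2 ^ θ` elements: one closes `S` under a choice of upper bounds
for families of fewer than `κ` elements. -/
lemma exists_isCardinalFiltered_superset {κ θ : Cardinal.{w}} [Fact κ.IsRegular] (hκ : κ ≤ θ)
    {A : Type u₁} [PartialOrder A] [IsCardinalFiltered A κ] (S : Set A)
    (hS : HasCardinalLT S (Order.succ (2 ^ θ))) :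
    ∃ B : Set A, S ⊆ B ∧ IsCardinalFiltered B κ ∧ HasCardinalLT B (Order.succ (2 ^ θ)) := by
  have hθ : ℵ₀ ≤ θ := (Fact.out : κ.IsRegular).aleph0_le.trans hκ
  have h2 : ℵ₀ ≤ (2 : Cardinal.{w}) ^ θ := hθ.trans (cantor θ).le
  have := hS.small
  have hT : #(Shrink.{w} S) ≤ 2 ^ θ := by
    rwa [hasCardinalLT_iff_of_equiv (equivShrink.{w} S), hasCardinalLT_iff_cardinal_mk_lt,
      Order.lt_succ_iff] at hS
  -- The terms of the free algebra on `S` with one operation of arity `E` for each subset `E`, of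
  -- cardinality less than `κ`, of a fixed type of cardinality `κ`.
  let β : Shrink.{w} S ⊕ {E : Set κ.out // HasCardinalLT E κ} → Type w :=
    Sum.elim (fun _ ↦ PEmpty) (fun E ↦ E.1)
  let step : (Σ a, β a → A) → A := fun x ↦
    match x with
    | ⟨.inl s, _⟩ => ((equivShrink.{w} S).symm s).1
    | ⟨.inr E, g⟩ => IsCardinalFiltered.max (κ := κ) g E.2
  have hW : #(WType β) ≤ 2 ^ θ := by
    refine WType.cardinalMk_le_of_le ?_
    have hle (a) : ((2 : Cardinal.{w}) ^ θ) ^ #(β a) ≤ 2 ^ θ := by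
      have : #(β a) ≤ θ := by
        rcases a with s | E
        · simp [β]
        · exact ((hasCardinalLT_iff_cardinal_mk_lt _ _).1 E.2).le.trans hκ
      rw [← power_mul]
      exact power_le_power_left two_ne_zero (mul_le_of_le hθ le_rfl this)
    refine (sum_le_sum _ (fun _ ↦ 2 ^ θ) hle).trans ?_
    rw [sum_const']
    refine mul_le_of_le h2 ?_ le_rfl
    rw [mk_sum, lift_id, lift_id]
    refine add_le_of_le h2 hT ((mk_subtype_le _).trans ?_)
    rw [mk_set, mk_out]
    exact power_le_power_left two_ne_zero hκ
  refine ⟨Set.range (WType.elim A step), fun s hs ↦ ?_, ?_, ?_⟩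
  · exact ⟨WType.mk (.inl (equivShrink.{w} S ⟨s, hs⟩)) PEmpty.elim, by simp [WType.elim, step]⟩
  · have hub ⦃ι : Type w⦄ (f : ι → Set.range (WType.elim A step)) (hι : HasCardinalLT ι κ) :
        ∃ b, ∀ k, f k ≤ b := by
      obtain ⟨e⟩ : Nonempty (ι ↪ κ.out) := by
        rw [← Cardinal.le_def, mk_out]
        exact ((hasCardinalLT_iff_cardinal_mk_lt _ _).1 hι).le
      choose t ht using fun k ↦ (f k).2
      let E : {E : Set κ.out // HasCardinalLT E κ} :=
        ⟨Set.range e, hι.of_surjective _ Set.rangeFactorization_surjective⟩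
      let q : E.1 ≃ ι := (Equiv.ofInjective e e.injective).symm
      refine ⟨⟨_, WType.mk (.inr E) (fun x ↦ t (q x)), rfl⟩, fun k ↦ ?_⟩
      have := leOfHom (IsCardinalFiltered.toMax (κ := κ)
        (fun x : E.1 ↦ WType.elim A step (t (q x))) E.2 (q.symm k))
      rw [Equiv.apply_symm_apply, ht] at this
      exact this
    rw [isCardinalFiltered_iff]
    refine ⟨fun ι f hι ↦ ?_, fun ι a b f _ ↦ ?_⟩
    · obtain ⟨b, hb⟩ := hub f hι
      exact ⟨b, fun k ↦ ⟨homOfLE (hb k)⟩⟩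
    · obtain ⟨l, hl⟩ := hub (fun x : ULift Bool ↦ bif x.down then a else b)
        (hasCardinalLT_of_finite _ _ (Fact.out : κ.IsRegular).aleph0_le)
      exact ⟨l, homOfLE (hl ⟨false⟩), homOfLE (hl ⟨true⟩), fun _ ↦ Subsingleton.elim _ _⟩
  · have : HasCardinalLT (WType β) (Order.succ (2 ^ θ)) := by
      rwa [hasCardinalLT_iff_cardinal_mk_lt, Order.lt_succ_iff]
    exact this.of_surjective _ Set.rangeFactorization_surjective

lemma isCardinalFiltered_lift_iff (J : Type u₁) [Category.{v₁} J] (κ : Cardinal.{w})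
    [Fact κ.IsRegular] :
    IsCardinalFiltered J (Cardinal.lift.{w'} κ) ↔ IsCardinalFiltered J κ :=
  ⟨fun _ ↦ ⟨fun F hA ↦ ⟨IsCardinalFiltered.cocone (κ := Cardinal.lift.{w'} κ) F (by simpa)⟩⟩,
    fun _ ↦ ⟨fun F hA ↦ ⟨IsCardinalFiltered.cocone (κ := κ) F (by simpa using hA)⟩⟩⟩

/-! ### Accessible extensions are fully faithful -/

lemma essentiallySmall_max (J : Type w) [SmallCategory J] : EssentiallySmall.{max w w'} J :=
  have : Small.{max w w'} J := small_max.{w', w} J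
  have : LocallySmall.{max w w'} J := ⟨fun _ _ ↦ small_max.{w', w} _⟩
  essentiallySmall_of_small_of_locallySmall J

namespace IsAccessibleExtension

variable {C : Type u₁} [Category.{v₁} C] {C' : Type u₂} [Category.{v₂} C']
  {κ : Cardinal.{w}} [Fact κ.IsRegular] {i : C ⥤ C'}

lemma isCardinalPresentable_obj (hi : IsAccessibleExtension.{w, w'} κ i) {k : C}
    (hk : isCardinalPresentable C κ k) :
    IsCardinalPresentable (i.obj k) (Cardinal.lift.{w', w} κ) :=
  hi.map_compact ⟨k, hk⟩

lemma exists_iso_obj (hi : IsAccessibleExtension.{w, w'} κ i) {k' : C'}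
    (hk' : isCardinalPresentable C' (Cardinal.lift.{w', w} κ) k') :
    ∃ k, isCardinalPresentable C κ k ∧ Nonempty (i.obj k ≅ k') := by
  have := hi.essSurj_compact
  obtain ⟨k, ⟨e⟩⟩ := this.mem_essImage ⟨k', hk'⟩
  exact ⟨k.obj, k.property, ⟨(ObjectProperty.ι _).mapIso e⟩⟩

/-- The functor on compact objects is fully faithful. -/
lemma map_bijective_of_compact (hi : IsAccessibleExtension.{w, w'} κ i) {k l : C}
    (hk : isCardinalPresentable C κ k) (hl : isCardinalPresentable C κ l) :
    Function.Bijective (i.map : (k ⟶ l) → _) := by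
  have := hi.full_compact
  have := hi.faithful_compact
  let Φ := (isCardinalPresentable C' (Cardinal.lift.{w', w} κ)).lift
    ((isCardinalPresentable C κ).ι ⋙ i) hi.map_compact
  refine ⟨fun f g h ↦ ?_, fun f ↦ ?_⟩
  · let X : (isCardinalPresentable C κ).FullSubcategory := ⟨k, hk⟩
    let Y : (isCardinalPresentable C κ).FullSubcategory := ⟨l, hl⟩
    have : (ObjectProperty.homMk f : X ⟶ Y) = ObjectProperty.homMk g :=
      Φ.map_injective (ObjectProperty.hom_ext _ h)
    exact congr_arg (·.hom) this
  · let X : (isCardinalPresentable C κ).FullSubcategory := ⟨k, hk⟩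
    let Y : (isCardinalPresentable C κ).FullSubcategory := ⟨l, hl⟩
    obtain ⟨g, hg⟩ := Φ.map_surjective (X := X) (Y := Y) (ObjectProperty.homMk f)
    exact ⟨g.hom, congr_arg (·.hom) hg⟩

/-- A morphism `i k ⟶ i x` with `k` compact factors through a compact object of a `κ`-filtered
presentation of `x`, since `i` preserves that presentation and `i k` is compact. -/
lemma map_bijective_of_compact_source (hi : IsAccessibleExtension.{w, w'} κ i) {k : C}
    (hk : isCardinalPresentable C κ k) (x : C) :
    Function.Bijective (i.map : (k ⟶ x) → _) := by
  have := hi.isCardinalAccessibleCategory_source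
  have := hi.isCardinalAccessible
  have := hi.isCardinalPresentable_obj hk
  have : IsCardinalPresentable k κ := hk
  obtain ⟨J, _, _, ⟨p⟩⟩ :=
    (isCardinalFilteredGenerator_isCardinalPresentable C κ).exists_colimitsOfShape x
  have := i.preservesColimitsOfShape_of_isCardinalAccessible κ J
  have := isFiltered_of_isCardinalFiltered J κ
  have : IsCardinalFiltered J (Cardinal.lift.{w', w} κ) :=
    (isCardinalFiltered_lift_iff J κ).2 inferInstance
  have := essentiallySmall_max.{w, w'} J
  have : EssentiallySmall.{w} J := essentiallySmall_max.{w, w} J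
  have hp := isColimitOfPreserves i p.isColimit
  refine ⟨fun f g h ↦ ?_, fun f ↦ ?_⟩
  · obtain ⟨a, f, rfl⟩ := IsCardinalPresentable.exists_hom_of_isColimit κ p.isColimit f
    obtain ⟨b, g, rfl⟩ := IsCardinalPresentable.exists_hom_of_isColimit κ p.isColimit g
    obtain ⟨c, u, v, huv⟩ := IsCardinalPresentable.exists_eq_of_isColimit
      (Cardinal.lift.{w', w} κ) hp (i.map f) (i.map g) (by simpa using h)
    have := (hi.map_bijective_of_compact hk (p.prop_diag_obj c)).1
      (a₁ := f ≫ p.diag.map u) (a₂ := g ≫ p.diag.map v) (by simpa using huv)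
    have := this =≫ p.ι.app c
    simpa using this
  · obtain ⟨a, f, rfl⟩ := IsCardinalPresentable.exists_hom_of_isColimit
      (Cardinal.lift.{w', w} κ) hp f
    obtain ⟨g, rfl⟩ := (hi.map_bijective_of_compact hk (p.prop_diag_obj a)).2 f
    exact ⟨g ≫ p.ι.app a, by simp⟩

/-- An accessible extension is fully faithful: `Hom(i x, i y)` is the limit of the sets
`Hom(i k, i y)`, where `k` runs through a `κ`-filtered presentation of `x` by compact objects. -/
lemma map_bijective (hi : IsAccessibleExtension.{w, w'} κ i) (x y : C) :
    Function.Bijective (i.map : (x ⟶ y) → _) := by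
  have := hi.isCardinalAccessibleCategory_source
  have := hi.isCardinalAccessible
  obtain ⟨J, _, _, ⟨p⟩⟩ :=
    (isCardinalFilteredGenerator_isCardinalPresentable C κ).exists_colimitsOfShape x
  have := i.preservesColimitsOfShape_of_isCardinalAccessible κ J
  have hp := isColimitOfPreserves i p.isColimit
  have hb (a : J) := hi.map_bijective_of_compact_source (p.prop_diag_obj a) y
  refine ⟨fun f g h ↦ p.isColimit.hom_ext fun a ↦ (hb a).1 ?_, fun f ↦ ?_⟩
  · simp [h]
  · choose g hg using fun a ↦ (hb a).2 (i.map (p.ι.app a) ≫ f)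
    let s : Cocone p.diag :=
      { pt := y
        ι.app := g
        ι.naturality a b u := (hb a).1 (by
          have := i.congr_map (p.w u)
          rw [i.map_comp] at this
          simp [hg, reassoc_of% this]) }
    refine ⟨p.isColimit.desc s, hp.hom_ext fun a ↦ ?_⟩
    have := i.congr_map (p.isColimit.fac s a)
    rw [i.map_comp] at this
    exact this.trans (hg a)

/-- For every object `c` of `C`, the object `i c` is `(μ, U⁺)`-compact for all large enough regular
cardinals `μ` of `U`, being a `U`-small colimit of compact objects. -/
lemma exists_isCardinalPresentable_obj (hi : IsAccessibleExtension.{w, w'} κ i) (c : C) :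
    ∃ α : Cardinal.{w}, ∀ (μ : Cardinal.{w}) [Fact μ.IsRegular], α ≤ μ →
      IsCardinalPresentable (i.obj c) (Cardinal.lift.{w', w} μ) := by
  have := hi.isCardinalAccessibleCategory_source
  have := hi.isCardinalAccessibleCategory_target
  have := hi.isCardinalAccessible
  obtain ⟨J, _, _, ⟨p⟩⟩ :=
    (isCardinalFilteredGenerator_isCardinalPresentable C κ).exists_colimitsOfShape c
  have := i.preservesColimitsOfShape_of_isCardinalAccessible κ J
  have : Small.{w} (Arrow J) := small_self _
  obtain ⟨α, -, hα⟩ := HasCardinalLT.exists_regular_cardinal.{w} (Arrow J)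
  refine ⟨max κ α, fun μ _ hμ ↦ ?_⟩
  have (a : J) : IsCardinalPresentable ((p.diag ⋙ i).obj a) (Cardinal.lift.{w', w} μ) :=
    have : IsCardinalPresentable ((p.diag ⋙ i).obj a) (Cardinal.lift.{w', w} κ) :=
      hi.isCardinalPresentable_obj (p.prop_diag_obj a)
    isCardinalPresentable_of_le (κ := Cardinal.lift.{w', w} κ) _
      (Cardinal.lift_le.2 ((le_max_left _ _).trans hμ))
  exact isCardinalPresentable_of_isColimit _ (isColimitOfPreserves i p.isColimit) _
    (by simpa using hα.of_le ((le_max_right _ _).trans hμ))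

end IsAccessibleExtension

/-! ### Colimits over a poset as colimits over a cover by directed subsets -/

section PartialColimits

variable {C : Type u₁} [Category.{v₁} C] {A : Type w} [PartialOrder A]

/-- The restriction of a functor `F` on a poset to a subset `B`. -/
abbrev restrict (F : A ⥤ C) (B : Set A) : B ⥤ C :=
  (Subtype.mono_coe (· ∈ B)).functor ⋙ F

/-- The morphism between colimits of restrictions that is induced by an inclusion of subsets. -/
noncomputable def colimitRestrictMap (F : A ⥤ C) {B B' : Set A} (h : B ⊆ B')
    [HasColimit (restrict F B)] [HasColimit (restrict F B')] :
    colimit (restrict F B) ⟶ colimit (restrict F B') :=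
  colimit.desc (restrict F B)
    { pt := colimit (restrict F B')
      ι.app b := colimit.ι (restrict F B') ⟨b.1, h b.2⟩
      ι.naturality b b' u :=
        (colimit.w (restrict F B')
          (homOfLE (leOfHom u) : (⟨b.1, h b.2⟩ : B') ⟶ ⟨b'.1, h b'.2⟩)).trans
          (Category.comp_id _).symm }

lemma ι_colimitRestrictMap (F : A ⥤ C) {B B' : Set A} (h : B ⊆ B')
    [HasColimit (restrict F B)] [HasColimit (restrict F B')] (b : B) :
    colimit.ι (restrict F B) b ≫ colimitRestrictMap F h =
      colimit.ι (restrict F B') ⟨b.1, h b.2⟩ :=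
  colimit.ι_desc _ _

/-- A functor `diag` whose value at each subset `B` that satisfies `P` is a colimit of `F`
restricted to `B`. The universal property is spelled out elementwise, with
`ι B a h : F.obj a ⟶ diag.obj B` for the colimit cocones. Descent is recorded only for the cocones
that are defined on all of `A`. -/
structure PartialColimits (F : A ⥤ C) (P : Set A → Prop) where
  /-- The functor formed by the colimits. -/
  diag : Subtype P ⥤ C
  /-- The colimit cocones. -/
  ι (B : Subtype P) (a : A) (h : a ∈ B.1) : F.obj a ⟶ diag.obj B
  map_ι (B : Subtype P) {a a' : A} (u : a ⟶ a') (h : a ∈ B.1) (h' : a' ∈ B.1) :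
    F.map u ≫ ι B a' h' = ι B a h
  ι_map {B B' : Subtype P} (u : B ⟶ B') (a : A) (h : a ∈ B.1) :
    ι B a h ≫ diag.map u = ι B' a (leOfHom u h)
  /-- The descent of a cocone. -/
  desc (c : Cocone F) (B : Subtype P) : diag.obj B ⟶ c.pt
  ι_desc (c : Cocone F) (B : Subtype P) (a : A) (h : a ∈ B.1) :
    ι B a h ≫ desc c B = c.ι.app a
  hom_ext {B : Subtype P} {X : C} {f g : diag.obj B ⟶ X}
    (h : ∀ a h, ι B a h ≫ f = ι B a h ≫ g) : f = g

namespace PartialColimits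

variable {F : A ⥤ C} {P : Set A → Prop}

/-- The partial colimits of a functor. -/
noncomputable def ofHasColimit (F : A ⥤ C) (P : Set A → Prop)
    [∀ B : Subtype P, HasColimit (restrict F B.1)] : PartialColimits F P where
  diag :=
    { obj B := colimit (restrict F B.1)
      map h := colimitRestrictMap F (leOfHom h)
      map_id B := colimit.hom_ext fun b ↦
        (ι_colimitRestrictMap F _ b).trans (Category.comp_id _).symm
      map_comp {B B' B''} h h' := colimit.hom_ext fun b ↦ by
        rw [reassoc_of% ι_colimitRestrictMap, ι_colimitRestrictMap]
        exact (ι_colimitRestrictMap F (leOfHom h') ⟨b.1, leOfHom h b.2⟩).symm }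
  ι B a h := colimit.ι (restrict F B.1) ⟨a, h⟩
  map_ι B a a' u h h' :=
    colimit.w (restrict F B.1) (homOfLE (leOfHom u) : (⟨a, h⟩ : B.1) ⟶ ⟨a', h'⟩)
  ι_map u a h := ι_colimitRestrictMap F (leOfHom u) ⟨a, h⟩
  desc c B := colimit.desc (restrict F B.1) (c.whisker (Subtype.mono_coe (· ∈ B.1)).functor)
  ι_desc _ _ _ _ := colimit.ι_desc _ _
  hom_ext h := colimit.hom_ext fun b ↦ h b.1 b.2

variable (p : PartialColimits F P)

/-- The component at `a` of a cocone over the partial colimits does not depend on the subset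
containing `a`, since any two subsets lie in a common one. -/
lemma ι_comp_eq [IsDirectedOrder (Subtype P)] (s : Cocone p.diag) {a : A} (B B' : Subtype P)
    (h : a ∈ B.1) (h' : a ∈ B'.1) : p.ι B a h ≫ s.ι.app B = p.ι B' a h' ≫ s.ι.app B' := by
  obtain ⟨B'', hB, hB'⟩ := exists_ge_ge B B'
  rw [← s.w (homOfLE hB), ← s.w (homOfLE hB'), reassoc_of% p.ι_map, reassoc_of% p.ι_map]

/-- If the subsets satisfying `P` are directed and cover `A`, then a colimit of `F` is also a
colimit of the partial colimits of `F`. -/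
noncomputable def colimitPresentation [IsDirectedOrder (Subtype P)]
    (hP : ∀ a, ∃ B : Subtype P, a ∈ B.1) {c : Cocone F} (hc : IsColimit c) :
    ColimitPresentation (Subtype P) c.pt where
  diag := p.diag
  ι :=
    { app := p.desc c
      naturality B B' u := p.hom_ext fun a h ↦ by
        simp [reassoc_of% p.ι_map, p.ι_desc] }
  isColimit :=
    { desc s := hc.desc
        { pt := s.pt
          ι.app a := p.ι (hP a).choose a (hP a).choose_spec ≫ s.ι.app (hP a).choose
          ι.naturality a a' u := by
            obtain ⟨B, hB, hB'⟩ := exists_ge_ge (hP a).choose (hP a').choose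
            have h : a ∈ B.1 := Subtype.coe_le_coe.2 hB (hP a).choose_spec
            have h' : a' ∈ B.1 := Subtype.coe_le_coe.2 hB' (hP a').choose_spec
            rw [p.ι_comp_eq s _ B _ h, p.ι_comp_eq s _ B _ h', reassoc_of% p.map_ι B u h h']
            exact (Category.comp_id _).symm }
      fac s B := p.hom_ext fun a ha ↦ by
        rw [reassoc_of% p.ι_desc, hc.fac]
        exact p.ι_comp_eq s _ B _ ha
      uniq s m hm := hc.hom_ext fun a ↦ by
        rw [hc.fac, ← p.ι_desc c _ a (hP a).choose_spec, Category.assoc]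
        exact congr_arg _ (hm _) }

end PartialColimits

end PartialColimits

/-! ### Presentations by objects in the essential image -/

namespace IsAccessibleExtension

variable {C : Type u₁} [Category.{v₁} C] {C' : Type u₂} [Category.{v₂} C']
  {κ : Cardinal.{w}} [Fact κ.IsRegular] {i : C ⥤ C'}

/-- The essential image of an accessible extension contains every colimit of an essentially
`U`-small `κ`-filtered diagram of compact objects: such a diagram lifts to `C`. -/
lemma essImage_of_colimitPresentation (hi : IsAccessibleExtension.{w, w'} κ i) {J : Type u₃}
    [Category.{v₃} J] [EssentiallySmall.{w} J] [IsCardinalFiltered J κ] {X : C'}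
    (p : ColimitPresentation J X)
    (hp : ∀ a, isCardinalPresentable C' (Cardinal.lift.{w', w} κ) (p.diag.obj a)) :
    i.essImage X := by
  have := hi.isCardinalAccessibleCategory_source
  have := hi.isCardinalAccessible
  have := hi.full_compact
  have := hi.faithful_compact
  have := hi.essSurj_compact
  let Φ := (isCardinalPresentable C' (Cardinal.lift.{w', w} κ)).lift
    ((isCardinalPresentable C κ).ι ⋙ i) hi.map_compact
  have : Φ.IsEquivalence := {}
  let E := (isCardinalPresentable C' (Cardinal.lift.{w', w} κ)).lift p.diag hp
  let G : J ⥤ C := E ⋙ Φ.inv ⋙ (isCardinalPresentable C κ).ι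
  have e : G ⋙ i ≅ p.diag :=
    Functor.isoWhiskerRight (Functor.isoWhiskerLeft E Φ.asEquivalence.counitIso)
      (isCardinalPresentable C' (Cardinal.lift.{w', w} κ)).ι
  have := IsCardinalFiltered.of_equivalence κ (equivSmallModel.{w} J)
  have := HasCardinalFilteredColimits.hasColimitsOfShape C κ (SmallModel.{w} J)
  have := hasColimitsOfShape_of_equivalence (C := C) (equivSmallModel.{w} J).symm
  have := i.preservesColimitsOfShape_of_isCardinalAccessible_of_essentiallySmall κ J
  exact ⟨colimit G, ⟨(isColimitOfPreserves i (colimit.isColimit G)).coconePointsIsoOfNatIso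
    p.isColimit e⟩⟩

/-- For arbitrarily large regular cardinals `μ` of `U`, every object of `C'` is the colimit of a
`U⁺`-small `μ`-filtered diagram of objects in the essential image of `C`. Indeed, write the object
as the colimit of compact objects indexed by a `κ`-directed poset, and take the colimits over all
`κ`-directed subsets with fewer than `μ` elements. -/
lemma exists_isCardinalFiltered_presentation (hi : IsAccessibleExtension.{w, w'} κ i)
    (α : Cardinal.{w}) :
    ∃ (μ : Cardinal.{w}) (_ : Fact μ.IsRegular), κ ≤ μ ∧ α ≤ μ ∧ ∀ X : C',
      ∃ (J : Type max w w') (_ : SmallCategory J)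
        (_ : IsCardinalFiltered J (Cardinal.lift.{w', w} μ)), i.essImage.colimitsOfShape J X := by
  have := hi.isCardinalAccessibleCategory_target
  let θ := max κ α
  -- A successor of a power of `2`, as `exists_isCardinalFiltered_superset` requires.
  have hθ : θ ≤ Order.succ (2 ^ θ) := (Cardinal.cantor θ).le.trans (Order.le_succ _)
  have hμ : (Order.succ ((2 : Cardinal.{w}) ^ θ)).IsRegular := Cardinal.isRegular_succ
    (((Fact.out : κ.IsRegular).aleph0_le.trans (le_max_left κ α)).trans (Cardinal.cantor θ).le)
  let μ := Order.succ ((2 : Cardinal.{w}) ^ θ)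
  have : Fact μ.IsRegular := ⟨hμ⟩
  refine ⟨μ, inferInstance, (le_max_left _ _).trans hθ, (le_max_right _ _).trans hθ,
    fun X ↦ ?_⟩
  obtain ⟨J, _, _, ⟨p⟩⟩ := (isCardinalFilteredGenerator_isCardinalPresentable C'
    (Cardinal.lift.{w', w} κ)).exists_colimitsOfShape X
  obtain ⟨A, _, hA, T, _⟩ :=
    IsCardinalFiltered.exists_cardinal_directed J (Cardinal.lift.{w', w} κ)
  replace hA := (isCardinalFiltered_lift_iff.{w, w'} A κ).1 hA
  replace p := p.reindex T
  let P : Set A → Prop := fun B ↦ IsCardinalFiltered B κ ∧ HasCardinalLT B μ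
  have hext (S : Set A) (hS : HasCardinalLT S μ) : ∃ B : Subtype P, S ⊆ B.1 := by
    obtain ⟨B, hSB, hB, hB'⟩ := exists_isCardinalFiltered_superset (le_max_left κ α) S hS
    exact ⟨⟨B, hB, hB'⟩, hSB⟩
  have hfilt : IsCardinalFiltered (Subtype P) (Cardinal.lift.{w', w} μ) :=
    isCardinalFiltered_preorder _ _ fun K s hK ↦ by
      obtain ⟨B, hB⟩ := hext (⋃ k, (s k).1) (hasCardinalLT_iUnion _
        ((hasCardinalLT_lift_iff K μ).1 ((hasCardinalLT_iff_cardinal_mk_lt _ _).2 hK))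
        fun k ↦ (s k).2.2)
      exact ⟨B, fun k ↦ (Set.subset_iUnion (fun k ↦ (s k).1) k).trans hB⟩
  have := isFiltered_of_isCardinalFiltered (Subtype P) (Cardinal.lift.{w', w} μ)
  have : IsDirectedOrder (Subtype P) := IsFiltered.isDirectedOrder _
  have (B : Subtype P) : HasColimit (restrict p.diag B.1) := by
    have := (isCardinalFiltered_lift_iff.{w, w'} B.1 κ).2 B.2.1
    have := HasCardinalFilteredColimits.hasColimitsOfShape C' (Cardinal.lift.{w', w} κ) B.1
    infer_instance
  have hcov (a : A) : ∃ B : Subtype P, a ∈ B.1 := by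
    obtain ⟨B, hB⟩ := hext {a} (hasCardinalLT_of_finite _ _ hμ.aleph0_le)
    exact ⟨B, hB rfl⟩
  let q := PartialColimits.ofHasColimit p.diag P
  refine ⟨Subtype P, inferInstance, hfilt, ⟨⟨q.colimitPresentation hcov p.isColimit, fun B ↦ ?_⟩⟩⟩
  have := B.2.1
  have := B.2.2.small
  have : EssentiallySmall.{w} B.1 :=
    have : LocallySmall.{w} B.1 := locallySmall_of_thin
    essentiallySmall_of_small_of_locallySmall _
  exact hi.essImage_of_colimitPresentation (.colimit (restrict p.diag B.1))
    fun b ↦ p.prop_diag_obj b.1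

end IsAccessibleExtension

/-! ### The Beck–Chevalley conditions -/

section BeckChevalley

variable {C : Type u₁} [Category.{v₁} C] {C' : Type u₂} [Category.{v₂} C']
  {D : Type u₃} [Category.{v₃} D] {D' : Type u₄} [Category.{v₄} D']
  {i : C ⥤ C'} {j : D ⥤ D'}

/-- Composition with the component of the mate at `c` corresponds, under the adjunction `F' ⊣ G'`,
to the map `Hom(j F c, d') → Hom(i c, G' d')` sending `g` to `i η ≫ α ≫ G' g`. Both sides commute with
sufficiently filtered colimits in `d'`, so it suffices that this map is bijective when `d'` is in
the essential image of `j`, where it is the bijection `Hom(F c, d) ≃ Hom(c, G d)`. -/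
theorem leftBeckChevalley_of_isAccessibleExtension {κ lam : Cardinal.{w}} [Fact κ.IsRegular]
    [Fact lam.IsRegular] (hi : IsAccessibleExtension.{w, w'} κ i)
    (hj : IsAccessibleExtension.{w, w'} lam j) {F : C ⥤ D} {G : D ⥤ C} {F' : C' ⥤ D'}
    {G' : D' ⥤ C'} [hG' : G'.IsCardinalAccessible (Cardinal.lift.{w', w} lam)] (adj : F ⊣ G)
    (adj' : F' ⊣ G') (α : G ⋙ i ≅ j ⋙ G') : LeftBeckChevalley adj adj' α := by
  let τ := (mateEquiv adj adj').symm (TwoSquare.mk G j i G' α.hom)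
  have hτ (c : C) : i.map (adj.unit.app c) ≫ α.hom.app (F.obj c) =
      adj'.unit.app (i.obj c) ≫ G'.map (τ.natTrans.app c) :=
    unit_mateEquiv_symm adj adj' (TwoSquare.mk G j i G' α.hom) c
  have (c : C) : IsIso (τ.natTrans.app c) := by
    let φ (d' : D') (g : j.obj (F.obj c) ⟶ d') : i.obj c ⟶ G'.obj d' :=
      i.map (adj.unit.app c) ≫ α.hom.app (F.obj c) ≫ G'.map g
    have φ_comp {d' d'' : D'} (g : j.obj (F.obj c) ⟶ d') (f : d' ⟶ d'') :
        φ d'' (g ≫ f) = φ d' g ≫ G'.map f := by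
      simp [φ]
    have hφj (d : D) : Function.Bijective (φ (j.obj d)) := by
      have e (g : F.obj c ⟶ d) : φ (j.obj d) (j.map g) =
          i.map (adj.homEquiv c d g) ≫ α.hom.app d := by
        have := α.hom.naturality g
        dsimp at this
        simp [φ, Adjunction.homEquiv_unit, this]
      rw [← Function.Bijective.of_comp_iff _ (hj.map_bijective (F.obj c) d)]
      have : φ (j.obj d) ∘ j.map = (fun f ↦ f ≫ α.hom.app d) ∘ i.map ∘ adj.homEquiv c d :=
        funext e
      rw [this]
      exact (((α.app d).homToEquiv (Z := i.obj c)).bijective).comp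
        ((hi.map_bijective c (G.obj d)).comp (adj.homEquiv c d).bijective)
    have hφess (d' : D') (hd' : j.essImage d') : Function.Bijective (φ d') := by
      obtain ⟨d, ⟨e⟩⟩ := hd'
      have : φ d' ∘ (fun g ↦ g ≫ e.hom) = (fun f ↦ f ≫ G'.map e.hom) ∘ φ (j.obj d) :=
        funext fun g ↦ φ_comp g e.hom
      rw [← Function.Bijective.of_comp_iff _ (e.homToEquiv (Z := j.obj (F.obj c))).bijective]
      change Function.Bijective (φ d' ∘ (fun g ↦ g ≫ e.hom))
      rw [this]
      exact ((G'.mapIso e).homToEquiv (Z := i.obj c)).bijective.comp (hφj d)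
    obtain ⟨α₁, hα₁⟩ := hi.exists_isCardinalPresentable_obj c
    obtain ⟨α₂, hα₂⟩ := hj.exists_isCardinalPresentable_obj (F.obj c)
    obtain ⟨μ, _, hlam, hα, hμ⟩ := hj.exists_isCardinalFiltered_presentation (max α₁ α₂)
    have := hα₁ μ ((le_max_left _ _).trans hα)
    have := hα₂ μ ((le_max_right _ _).trans hα)
    have hφ (d' : D') : Function.Bijective (φ d') := by
      obtain ⟨J, _, _, ⟨p⟩⟩ := hμ d'
      have : IsCardinalFiltered J (Cardinal.lift.{w', w} lam) :=
        .of_le J (Cardinal.lift_le.2 hlam)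
      have := G'.preservesColimitsOfShape_of_isCardinalAccessible (Cardinal.lift.{w', w} lam) J
      have hp := isColimitOfPreserves G' p.isColimit
      have : EssentiallySmall.{max w w'} J := essentiallySmall_max.{max w w', max w w'} J
      refine ⟨fun g₁ g₂ h ↦ ?_, fun f ↦ ?_⟩
      · obtain ⟨a₁, g₁, rfl⟩ := IsCardinalPresentable.exists_hom_of_isColimit
          (Cardinal.lift.{w', w} μ) p.isColimit g₁
        obtain ⟨a₂, g₂, rfl⟩ := IsCardinalPresentable.exists_hom_of_isColimit
          (Cardinal.lift.{w', w} μ) p.isColimit g₂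
        obtain ⟨b, u₁, u₂, hu⟩ := IsCardinalPresentable.exists_eq_of_isColimit
          (Cardinal.lift.{w', w} μ) hp (φ _ g₁) (φ _ g₂) (by
            rwa [φ_comp, φ_comp] at h)
        have := (hφess _ (p.prop_diag_obj b)).1
          (a₁ := g₁ ≫ p.diag.map u₁) (a₂ := g₂ ≫ p.diag.map u₂) (by
            rw [φ_comp, φ_comp]
            exact hu)
        simpa using this =≫ p.ι.app b
      · obtain ⟨a, f, rfl⟩ := IsCardinalPresentable.exists_hom_of_isColimit
          (Cardinal.lift.{w', w} μ) hp f
        obtain ⟨g, rfl⟩ := (hφess _ (p.prop_diag_obj a)).2 f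
        exact ⟨g ≫ p.ι.app a, φ_comp _ _⟩
    rw [isIso_iff_coyoneda_map_bijective]
    intro d'
    rw [← Function.Bijective.of_comp_iff' (adj'.homEquiv (i.obj c) d').bijective]
    have : adj'.homEquiv (i.obj c) d' ∘ (fun g ↦ τ.natTrans.app c ≫ g) = φ d' := funext fun g ↦ by
      simp [φ, Adjunction.homEquiv_unit, reassoc_of% hτ]
    exact this ▸ hφ d'
  exact NatIso.isIso_of_isIso_app _

/-- Composition with the component of the mate at `d` corresponds, under the adjunction `F' ⊣ G'`,
to the map `Hom(c', i G d) → Hom(F' c', j d)` sending `g` to `F' g ≫ β ≫ j ε`. It suffices that this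
map is bijective for `c'` in a strong generator, such as the objects `i k` with `k` compact, where
it is the bijection `Hom(k, G d) ≃ Hom(F k, d)`. -/
theorem rightBeckChevalley_of_isAccessibleExtension {κ : Cardinal.{w}} [Fact κ.IsRegular]
    (hi : IsAccessibleExtension.{w, w'} κ i) [j.Full] [j.Faithful] {F : C ⥤ D} {G : D ⥤ C}
    {F' : C' ⥤ D'} {G' : D' ⥤ C'} (adj : F ⊣ G) (adj' : F' ⊣ G') (β : i ⋙ F' ≅ F ⋙ j) :
    RightBeckChevalley adj adj' β := by
  have := hi.isCardinalAccessibleCategory_target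
  let τ := mateEquiv adj adj' (TwoSquare.mk i F F' j β.hom)
  have hτ (d : D) : F'.map (τ.natTrans.app d) ≫ adj'.counit.app (j.obj d) =
      β.hom.app (G.obj d) ≫ j.map (adj.counit.app d) :=
    mateEquiv_counit adj adj' (TwoSquare.mk i F F' j β.hom) d
  have (d : D) : IsIso (τ.natTrans.app d) := by
    have key (k' : C') (hk' : isCardinalPresentable C' (Cardinal.lift.{w', w} κ) k') :
        Function.Bijective (fun g : k' ⟶ i.obj (G.obj d) ↦ g ≫ τ.natTrans.app d) := by
      obtain ⟨k, hk, ⟨e⟩⟩ := hi.exists_iso_obj hk'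
      -- Both hom-sets are identified with `Hom(F k, d)`, through full faithfulness of `i` for the
      -- source and of `j` for the target.
      let ψ : (k' ⟶ i.obj (G.obj d)) ≃ (F.obj k ⟶ d) :=
        (e.symm.homCongr (Iso.refl _)).trans
          ((Equiv.ofBijective _ (hi.map_bijective k (G.obj d))).symm.trans
            (adj.homEquiv k d).symm)
      let χ : (k' ⟶ G'.obj (j.obj d)) ≃ (F.obj k ⟶ d) :=
        (e.symm.homCongr (Iso.refl _)).trans ((adj'.homEquiv _ _).symm.trans
          (((β.app k).homCongr (Iso.refl _)).trans (Equiv.ofBijective _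
            ⟨j.map_injective, j.map_surjective⟩).symm))
      have hχ : χ ∘ (fun g : k' ⟶ i.obj (G.obj d) ↦ g ≫ τ.natTrans.app d) = ψ := by
        funext g
        obtain ⟨f, rfl⟩ : ∃ f, e.inv ≫ i.map f = g := by
          obtain ⟨f, hf⟩ := (hi.map_bijective k (G.obj d)).2 (e.hom ≫ g)
          exact ⟨f, by simp [hf]⟩
        have hψ : ψ (e.inv ≫ i.map f) = F.map f ≫ adj.counit.app d := by
          have : (Equiv.ofBijective _ (hi.map_bijective k (G.obj d))).symm (i.map f) = f :=
            Equiv.ofBijective_symm_apply_apply _ _ f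
          simp [ψ, Adjunction.homEquiv_counit, this]
        have hβ := β.hom.naturality f
        dsimp at hβ
        apply j.map_injective
        have hj (t : j.obj (F.obj k) ⟶ j.obj d) : j.map ((Equiv.ofBijective _
            ⟨j.map_injective, j.map_surjective⟩ : (F.obj k ⟶ d) ≃ _).symm t) = t :=
          Equiv.ofBijective_apply_symm_apply _ _ t
        rw [hψ]
        simp [χ, hj, Adjunction.homEquiv_counit, hτ, reassoc_of% hβ]
      rw [← Function.Bijective.of_comp_iff' χ.bijective, hχ]
      exact ψ.bijective
    have hgen := (isCardinalFilteredGenerator_isCardinalPresentable C'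
      (Cardinal.lift.{w', w} κ)).isStrongGenerator
    have : Mono (τ.natTrans.app d) := ⟨fun g₁ g₂ h ↦ hgen.isSeparating _ _ fun k' hk' t ↦
      (key k' hk').1 (by simp [h])⟩
    exact hgen.isIso_of_mono _ fun k' hk' ↦ (key k' hk').2
  exact NatIso.isIso_of_isIso_app _

end BeckChevalley

end UniverseEnlargement

theorem mainTheorem1
    (κ lam : Cardinal.{w}) [Fact κ.IsRegular] [Fact lam.IsRegular] (_hκlam : κ ≤ lam)
    (C : Type u₁) [Category.{v₁} C] [IsCardinalLocallyPresentable C κ]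
    (D : Type u₂) [Category.{v₂} D] [IsCardinalLocallyPresentable D lam]
    (C' : Type u₃) [Category.{v₃} C']
    [IsCardinalLocallyPresentable C' (Cardinal.lift.{max (w + 1) w', w} κ)]
    (D' : Type u₄) [Category.{v₄} D']
    [IsCardinalLocallyPresentable D' (Cardinal.lift.{max (w + 1) w', w} lam)]
    (i : C ⥤ C')
    (_hi : UniverseEnlargement.IsAccessibleExtension.{w, max (w + 1) w'} κ i)
    (j : D ⥤ D') [j.Full] [j.Faithful] :
    (∀ (G : D ⥤ C) (G' : D' ⥤ C') (h : G ⋙ i = j ⋙ G'),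
      G.IsCardinalAccessible lam →
      G'.IsCardinalAccessible (Cardinal.lift.{max (w + 1) w', w} lam) →
      UniverseEnlargement.IsAccessibleExtension.{w, max (w + 1) w'} lam j →
      ∀ (F : C ⥤ D) (F' : C' ⥤ D') (adj : F ⊣ G) (adj' : F' ⊣ G'),
        UniverseEnlargement.LeftBeckChevalley adj adj' (eqToIso h)) ∧
    (∀ (F : C ⥤ D) (F' : C' ⥤ D') (h : i ⋙ F' = F ⋙ j)
      (G : D ⥤ C) (G' : D' ⥤ C') (adj : F ⊣ G) (adj' : F' ⊣ G'),
        UniverseEnlargement.RightBeckChevalley adj adj' (eqToIso h)) := by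
  refine ⟨fun G G' h _ _ hj F F' adj adj' ↦ ?_, fun F F' h G G' adj adj' ↦ ?_⟩
  · exact UniverseEnlargement.leftBeckChevalley_of_isAccessibleExtension _hi hj adj adj' _
  · exact UniverseEnlargement.rightBeckChevalley_of_isAccessibleExtension _hi adj adj' _
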